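/- Let $\mathcal{H}$ and $\mathcal{K}$ be finite-dimensional complex Hilbert spaces, let $\rho$ be a positive definite operator on $\mathcal{H}$ with $\operatorname{Tr}\rho=1$, let $\sigma$ be a positive definite operator on $\mathcal{H}$ (of arbitrary trace), and let $\mathcal{N}:\mathcal{B}(\mathcal{H})\to\mathcal{B}(\mathcal{K})$ be a strict CPTP map, i.e. a completely positive trace-preserving linear map that sends positive definite operators to positive definite operators. Let $\mathcal{N}^{\dagger}$ be the adjoint of $\mathcal{N}$ with respect to the Hilbert--Schmidt inner products $\langle C,D\rangle=\operatorname{Tr}(C^{\dagger}D)$, and let $$\mathcal{R}^{P}_{\sigma,\mathcal{N}}(\omega)=\sigma^{1/2}\,\mathcal{N}^{\dagger}\!\left(\mathcal{N}(\sigma)^{-1/2}\,\omega\,\mathcal{N}(\sigma)^{-1/2}\right)\sigma^{1/2}$$ be the Petz recovery map. For positive semidefinite $\omega,\tau$ put $$D_{\min}(\omega\|\tau)=-\log_2\left\|\sqrt{\omega}\sqrt{\tau}\right\|_1^2,\qquad D_{\max}(\omega\|\tau)=\inf\{\lambda\in\mathbb{R}:\omega\le 2^{\lambda}\tau\},$$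 with values in $[-\infty,+\infty]$, where $\|X\|_1=\operatorname{Tr}\sqrt{X^{\dagger}X}$, $-\log_2 0=+\infty$ and $\inf\emptyset=+\infty$. Define $$\Delta_{\min}(\rho,\sigma,\mathcal{N})=D_{\min}\big(\rho\,\big\|\,\mathcal{R}^{P}_{\sigma,\mathcal{N}}(\mathcal{N}(\rho))\big),\qquad \Delta_{\max}(\rho,\sigma,\mathcal{N})=D_{\max}\big(\rho\,\big\|\,\mathcal{R}^{P}_{\sigma,\mathcal{N}}(\mathcal{N}(\rho))\big).$$ Then $$\Delta_{\min}(\rho,\sigma,\mathcal{N})\ge 0\quad\text{and}\quad \Delta_{\max}(\rho,\sigma,\mathcal{N})\ge 0 .$$ Moreover, each of the two equalities $\Delta_{\min}(\rho,\sigma,\mathcal{N})=0$ and $\Delta_{\max}(\rho,\sigma,\mathcal{N})=0$ holds if and only if $\mathcal{N}$ is sufficient for $\rho$ and $\sigma$, i.e. if and only if there is a completely positive trace-preserving linear map $\mathcal{R}:\mathcal{B}(\mathcal{K})\to\mathcal{B}(\mathcal{H})$ with $\mathcal{R}(\mathcal{N}(\rho))=\rho$ and $\mathcal{R}(\mathcal{N}(\sigma))=\sigma$.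 -/

import Mathlib

noncomputable section

namespace MinMaxRecovery

open scoped CStarAlgebra

/-- The algebra `B(H)` of bounded linear operators on `H`, with Mathlib's C⋆-algebra structure and
Loewner order. Positive semidefinite means `0 ≤ A`; positive definite means
`IsStrictlyPositive A`, i.e. `0 ≤ A` and `A` is invertible. -/
abbrev Op (H : Type*) [NormedAddCommGroup H] [InnerProductSpace ℂ H] : Type _ := H →L[ℂ] H

section Single

variable {H : Type*} [NormedAddCommGroup H] [InnerProductSpace ℂ H]

/-- The trace of an operator on a finite-dimensional space. -/
def tr (A : Op H) : ℂ := LinearMap.trace ℂ H A.toLinearMap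

theorem op_expansion [FiniteDimensional ℂ H] (A : Op H) :
    A = ∑ i, ∑ j,
      inner ℂ (stdOrthonormalBasis ℂ H i) (A (stdOrthonormalBasis ℂ H j)) •
        (InnerProductSpace.rankOne ℂ (stdOrthonormalBasis ℂ H i)
          (stdOrthonormalBasis ℂ H j) : Op H) := by
  set b := stdOrthonormalBasis ℂ H
  refine ContinuousLinearMap.coe_injective (b.toBasis.ext fun k => ?_)
  have h (j) : inner ℂ (b j) (b k) = if j = k then (1 : ℂ) else 0 :=
    orthonormal_iff_ite.mp b.orthonormal j k
  simp [h, b.sum_repr']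

variable [CompleteSpace H]

/-- The Hilbert-Schmidt inner product `⟨C, D⟩ = Tr(C† D)`. -/
def hsInner (C D : Op H) : ℂ := tr (star C * D)

theorem tr_star [FiniteDimensional ℂ H] (A : Op H) : tr (star A) = star (tr A) := by
  have b := stdOrthonormalBasis ℂ H
  simp only [tr, LinearMap.trace_eq_sum_inner _ b, star_sum]
  refine Finset.sum_congr rfl fun i _ => ?_
  simp [ContinuousLinearMap.star_eq_adjoint, ContinuousLinearMap.adjoint_inner_right]

theorem hsInner_symm [FiniteDimensional ℂ H] (C D : Op H) : hsInner C D = star (hsInner D C) := by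
  rw [hsInner, hsInner, ← tr_star, star_mul, star_star]

theorem hsInner_rankOne [FiniteDimensional ℂ H] (C : Op H) (x y : H) :
    hsInner C (InnerProductSpace.rankOne ℂ x y) = inner ℂ y (star C x) := by
  rw [hsInner, tr, ContinuousLinearMap.mul_def, InnerProductSpace.comp_rankOne,
    InnerProductSpace.trace_rankOne]

theorem hsInner_smul_right (C D : Op H) (c : ℂ) : hsInner C (c • D) = c * hsInner C D := by
  simp [hsInner, tr]

theorem hsInner_sum_right {ι : Type*} (s : Finset ι) (C : Op H) (D : ι → Op H) :
    hsInner C (∑ i ∈ s, D i) = ∑ i ∈ s, hsInner C (D i) := by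
  simp [hsInner, tr, Finset.mul_sum]

/-- Positive definite density operators. -/
def IsPosDefState (ρ : Op H) : Prop := IsStrictlyPositive ρ ∧ tr ρ = 1

/-- The fidelity `F(ρ, τ) = ‖√ρ √τ‖₁²`, where `‖X‖₁ = Tr |X|` and `|X| = √(X† X)`. -/
def fidelity (ρ τ : Op H) : ℝ := (tr (CFC.abs (CFC.sqrt ρ * CFC.sqrt τ))).re ^ 2

/-- The min-relative entropy `-log₂ F(ρ, τ)`, which is `+∞` when `F(ρ, τ) = 0`. -/
def Dmin (ρ τ : Op H) : EReal :=
  if fidelity ρ τ = 0 then ⊤ else ((-Real.logb 2 (fidelity ρ τ) : ℝ) : EReal)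

/-- The max-relative entropy `inf {l : ρ ≤ 2 ^ l τ}`, which is `+∞` when there is no such real
number `l`. -/
def Dmax (ρ τ : Op H) : EReal :=
  sInf {x : EReal | ∃ l : ℝ, ρ ≤ (((2 : ℝ) ^ l : ℝ) : ℂ) • τ ∧ x = (l : EReal)}

end Single

section Maps

variable {H K : Type*} [NormedAddCommGroup H] [InnerProductSpace ℂ H] [CompleteSpace H]
  [NormedAddCommGroup K] [InnerProductSpace ℂ K] [CompleteSpace K]

/-- Quantum channels: completely positive trace-preserving (CPTP) linear maps. -/
structure IsCPTP (N : Op H →ₗ[ℂ] Op K) : Prop where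
  completely_positive : ∃ Φ : Op H →CP Op K, Φ.toLinearMap = N
  trace_preserving : ∀ A : Op H, tr (N A) = tr A

/-- Strict CPTP maps: CPTP maps that send positive definite operators to positive definite
operators. -/
structure IsStrictCPTP (N : Op H →ₗ[ℂ] Op K) : Prop extends IsCPTP N where
  strict : ∀ A : Op H, IsStrictlyPositive A → IsStrictlyPositive (N A)

/-- `N` is sufficient for `ρ` and `σ`: a recovery channel undoes `N` on both of them. -/
def IsSufficient (N : Op H →ₗ[ℂ] Op K) (ρ σ : Op H) : Prop :=
  ∃ R : Op K →ₗ[ℂ] Op H, IsCPTP R ∧ R (N ρ) = ρ ∧ R (N σ) = σ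

variable [FiniteDimensional ℂ H]

/-- The adjoint `N†` of `N` for the Hilbert-Schmidt inner products, written out in the
orthonormal basis `|eᵢ⟩⟨eⱼ|` of `B(H)`; `hsInner_hsAdjoint` and `eq_hsAdjoint` below show that it
is the unique map with `⟨B, N(A)⟩ = ⟨N†(B), A⟩`. -/
def hsAdjoint (N : Op H →ₗ[ℂ] Op K) (B : Op K) : Op H :=
  ∑ i, ∑ j,
    hsInner
        (N (InnerProductSpace.rankOne ℂ (stdOrthonormalBasis ℂ H i) (stdOrthonormalBasis ℂ H j)))
        B •
      (InnerProductSpace.rankOne ℂ (stdOrthonormalBasis ℂ H i) (stdOrthonormalBasis ℂ H j) : Op H)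

theorem hsInner_hsAdjoint [FiniteDimensional ℂ K] (N : Op H →ₗ[ℂ] Op K) (A : Op H) (B : Op K) :
    hsInner B (N A) = hsInner (hsAdjoint N B) A := by
  rw [hsInner_symm (hsAdjoint N B) A]
  conv_lhs => rw [op_expansion A]
  simp only [hsAdjoint, map_sum, map_smul, hsInner_sum_right, hsInner_smul_right, star_sum,
    star_mul']
  refine Finset.sum_congr rfl fun i _ => Finset.sum_congr rfl fun j _ => ?_
  rw [← hsInner_symm, hsInner_rankOne, mul_comm, ContinuousLinearMap.star_eq_adjoint,
    ContinuousLinearMap.adjoint_inner_right, ← starRingEnd_apply, inner_conj_symm]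

theorem eq_hsAdjoint [FiniteDimensional ℂ K] (N : Op H →ₗ[ℂ] Op K) (M : Op K → Op H)
    (hM : ∀ A B, hsInner B (N A) = hsInner (M B) A) : M = hsAdjoint N := by
  funext B
  refine star_injective (ContinuousLinearMap.ext fun x => ext_inner_left ℂ fun y => ?_)
  rw [← hsInner_rankOne, ← hsInner_rankOne, ← hM, hsInner_hsAdjoint]

/-- The Petz recovery map
`R(ω) = σ^{1/2} N†(N(σ)^{-1/2} ω N(σ)^{-1/2}) σ^{1/2}`. -/
def petz (σ : Op H) (N : Op H →ₗ[ℂ] Op K) (ω : Op K) : Op H :=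
  σ ^ (1 / 2 : ℝ) *
      hsAdjoint N ((N σ) ^ (-1 / 2 : ℝ) * ω * (N σ) ^ (-1 / 2 : ℝ)) *
    σ ^ (1 / 2 : ℝ)

/-- `Δ_min(ρ, σ, N)`. -/
def deltaMin (ρ σ : Op H) (N : Op H →ₗ[ℂ] Op K) : EReal := Dmin ρ (petz σ N (N ρ))

/-- `Δ_max(ρ, σ, N)`. -/
def deltaMax (ρ σ : Op H) (N : Op H →ₗ[ℂ] Op K) : EReal := Dmax ρ (petz σ N (N ρ))

end Maps

end MinMaxRecovery

end

/-!
The image `τ` of `N ρ` under the Petz map is a positive definite state. For such a state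
`Dmin ρ τ` and `Dmax ρ τ` are nonnegative and vanish only at `τ = ρ`. For `Dmin`, a polar
decomposition `|√ρ √τ| = U† √ρ √τ` gives `‖√ρ U - √τ‖² = 2 - 2 Tr |√ρ √τ|` in the Hilbert-Schmidt
norm (`re_tr_abs_le_one`). For `Dmax`, the inequality `ρ ≤ 2 ^ l τ` forces `1 ≤ 2 ^ l` on traces,
and a vanishing infimum gives `ρ ≤ τ`, hence `ρ = τ`. So it remains to show that `N` is sufficient
for `ρ` and `σ` if and only if the Petz map recovers `ρ` (`isSufficient_iff`).

If it does, then the Petz map itself is the recovery channel: it is completely positive and trace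
preserving, and it always recovers `σ`. Complete positivity is handled through the forms
`∑ᵢⱼ ⟨xᵢ, Φ(aᵢ† aⱼ) xⱼ⟩` (`IsPosForm`), a condition that passes easily to the adjoint of a map and
from which the Kadison-Schwarz inequality can be read off.

The converse is Petz's theorem (`petz_apply_eq_of_isSufficient`). For `s > 0` the functional
`Tr ρ A A† + s Tr σ (1 - A)† (1 - A)` has a unique minimizer `A`, the solution of
`ρ A + s A σ = s σ`, that is, `A = s (Δ + s)⁻¹ 1` for the relative modular operator
`Δ(A) = ρ A σ⁻¹`. By the Kadison-Schwarz inequality `N†` does not increase the functional. When a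
recovery channel exists, the two minimal values therefore agree and `N†` maps the minimizer for
`(N ρ, N σ)` to the one for `(ρ, σ)` (`hsAdjoint_eq_of_recovery`). Both are finite sums of partial
fractions `s / (r + s)` with operator coefficients, and these functions of `s` are linearly
independent, so `s / (r + s)` may be replaced by `√r`; this gives `N†(Y) = X` for
`X = √ρ σ^{-1/2}` and `Y = √(N ρ) (N σ)^{-1/2}` (`hsAdjoint_sqrt_mul_rpow`). Finally
`N†(Y† Y) - X† X` is positive and has trace zero against `σ`, so it vanishes, which is the recovery
of `ρ`.
-/

noncomputable section

namespace MinMaxRecovery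

open scoped CStarAlgebra InnerProductSpace

/-! ### Complete positivity on vectors -/

section Algebra

variable {A : Type*} [NonUnitalCStarAlgebra A] [PartialOrder A] [StarOrderedRing A]

theorem exists_eq_star_mul_self {a : A} (ha : 0 ≤ a) : ∃ c, a = star c * c :=
  CStarAlgebra.nonneg_iff_eq_star_mul_self.mp ha

/-- Compressing `m` by its negative part `s` gives `-s³ = -c† c` with `c = s^{3/2}`. Hence `m` is
positive as soon as this compression is known to be positive as well. -/
theorem exists_conj_eq_neg_star_mul_self (m : A) (hm : IsSelfAdjoint m) :
    ∃ s c : A, star s = s ∧ s * m * s = -(star c * c) ∧ (c = 0 → 0 ≤ m) := by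
  set S := m⁻ with hS
  have hS0 : 0 ≤ S := CFC.negPart_nonneg m
  have hSs : star S = S := (IsSelfAdjoint.of_nonneg hS0).star_eq
  set T := CFC.sqrt S with hT
  have hTs : star T = T := (IsSelfAdjoint.of_nonneg (CFC.sqrt_nonneg S)).star_eq
  have hTT : T * T = S := CFC.sqrt_mul_sqrt_self S
  refine ⟨S, T * S, hSs, ?_, fun hC => ?_⟩
  · have h1 : m = m⁺ - S := (CFC.posPart_sub_negPart m hm).symm
    have h2 : S * m⁺ = 0 := CFC.negPart_mul_posPart m
    rw [star_mul, hTs, hSs, mul_assoc S T, ← mul_assoc T T, hTT, ← mul_assoc]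
    conv_lhs => rw [h1]
    rw [mul_sub, h2, zero_sub, neg_mul]
  · rw [CStarAlgebra.nonneg_iff_isSelfAdjoint_and_negPart_eq_zero]
    refine ⟨hm, (CStarRing.star_mul_self_eq_zero_iff S).mp ?_⟩
    rw [hSs]
    nth_rw 1 [← hTT]
    rw [mul_assoc, hC, mul_zero]

end Algebra

section CP

variable {H K : Type*} [NormedAddCommGroup H] [InnerProductSpace ℂ H] [CompleteSpace H]
  [NormedAddCommGroup K] [InnerProductSpace ℂ K] [CompleteSpace K]

/-- Complete positivity as a condition on vectors: all expressions `∑ᵢⱼ ⟨xᵢ, Φ(aᵢ† aⱼ) xⱼ⟩` have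
nonnegative real part. For maps that commute with `star` it is equivalent to positivity of all
the amplifications of `Φ` to matrices over `B(H)`. -/
def IsPosForm (Φ : Op H →ₗ[ℂ] Op K) : Prop :=
  ∀ (n : ℕ) (a : Fin n → Op H) (x : Fin n → K),
    0 ≤ (∑ i, ∑ j, inner ℂ (x i) (Φ (star (a i) * a j) (x j))).re

theorem inner_star_mul (A B : Op H) (x y : H) :
    inner ℂ x ((star A * B) y) = inner ℂ (A x) (B y) := by
  simp [ContinuousLinearMap.star_eq_adjoint, ContinuousLinearMap.adjoint_inner_right]

theorem op_nonneg_iff (A : Op H) :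
    0 ≤ A ↔ IsSelfAdjoint A ∧ ∀ x, 0 ≤ (inner ℂ x (A x)).re := by
  rw [ContinuousLinearMap.nonneg_iff_isPositive, ContinuousLinearMap.isPositive_def']
  refine and_congr_right fun _ => forall_congr' fun x => ?_
  rw [ContinuousLinearMap.reApplyInnerSelf_apply, ← inner_re_symm]
  rfl

theorem re_sum_inner_star_mul_nonneg {n : ℕ} (C : CStarMatrix (Fin n) (Fin n) (Op H))
    (x : Fin n → H) :
    0 ≤ (∑ i, ∑ j, inner ℂ (x i) ((star C * C) i j (x j))).re := by
  have h : ∑ i, ∑ j, inner ℂ (x i) ((star C * C) i j (x j)) =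
      ∑ k, inner ℂ (∑ i, C k i (x i)) (∑ j, C k j (x j)) := by
    simp only [sum_inner, inner_sum, CStarMatrix.mul_apply, CStarMatrix.star_apply,
      _root_.sum_apply, inner_star_mul]
    rw [Finset.sum_comm_cycle]
    refine Finset.sum_congr rfl fun k _ => ?_
    rw [Finset.sum_comm]
  rw [h, Complex.re_sum]
  exact Finset.sum_nonneg fun k _ => inner_self_nonneg (𝕜 := ℂ)

theorem IsPosForm.of_completelyPositive (Φ : Op H →CP Op K) : IsPosForm Φ.toLinearMap := by
  intro n a x
  cases n with
  | zero => simp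
  | succ n =>
    -- The matrix `(aᵢ† aⱼ)` is `B† B` for the matrix `B` with the single nonzero row `a`.
    let B : CStarMatrix (Fin (n + 1)) (Fin (n + 1)) (Op H) :=
      CStarMatrix.ofMatrix fun k j => if k = 0 then a j else 0
    have hB : ∀ i j, (star B * B) i j = star (a i) * a j := by
      intro i j
      simp only [CStarMatrix.mul_apply, CStarMatrix.star_apply]
      rw [Finset.sum_eq_single 0 (fun k _ hk => ?_) (by simp)]
      · rfl
      · rw [show B k j = 0 from if_neg hk, mul_zero]
    have h := Φ.map_cstarMatrix_nonneg' (n + 1) _ (star_mul_self_nonneg B)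
    obtain ⟨C, hC⟩ := exists_eq_star_mul_self h
    have := re_sum_inner_star_mul_nonneg C x
    rw [← hC] at this
    simpa [hB] using this

/-- A self-adjoint matrix over `B(H)` whose quadratic form on `H^n` is nonnegative is positive in
the C⋆-algebra of matrices. -/
theorem nonneg_of_re_sum_inner_nonneg {n : ℕ} (M : CStarMatrix (Fin n) (Fin n) (Op H))
    (hM : IsSelfAdjoint M)
    (h : ∀ x : Fin n → H, 0 ≤ (∑ i, ∑ j, inner ℂ (x i) (M i j (x j))).re) : 0 ≤ M := by
  obtain ⟨S, C, hSs, hSMS, hC⟩ := exists_conj_eq_neg_star_mul_self M hM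
  refine hC ?_
  ext k i x
  have e : ∑ k, ∑ l, inner ℂ (S k i x) (M k l (S l i x)) = inner ℂ x ((S * M * S) i i x) := by
    simp only [CStarMatrix.mul_apply, Finset.sum_mul, _root_.sum_apply, inner_sum]
    rw [Finset.sum_comm]
    refine Finset.sum_congr rfl fun l _ => Finset.sum_congr rfl fun k _ => ?_
    have h1 : S i k = star (S k i) := by
      conv_lhs => rw [← hSs, CStarMatrix.star_apply]
    rw [h1, mul_assoc, inner_star_mul]
    rfl
  have h3 := h fun k => S k i x
  rw [e, hSMS, CStarMatrix.neg_apply, CStarMatrix.mul_apply] at h3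
  simp only [CStarMatrix.star_apply, _root_.neg_apply,
    _root_.sum_apply, inner_neg_right, inner_sum, inner_star_mul, Complex.neg_re,
    Complex.re_sum] at h3
  have h4 : ∀ k ∈ Finset.univ, 0 ≤ (inner ℂ ((C) k i x) ((C) k i x)).re :=
    fun k _ => inner_self_nonneg (𝕜 := ℂ)
  have h5 := (Finset.sum_eq_zero_iff_of_nonneg h4).mp
    (le_antisymm (by linarith) (Finset.sum_nonneg h4)) k (Finset.mem_univ k)
  have h6 : (C) k i x = 0 := by
    rw [← norm_eq_zero, ← sq_eq_zero_iff]
    simpa only [inner_self_eq_norm_sq_to_K, ← Complex.ofReal_pow, Complex.ofReal_re,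
      Complex.coe_algebraMap] using h5
  rw [h6]; rfl

theorem IsPosForm.exists_completelyPositive {Φ : Op H →ₗ[ℂ] Op K} (h : IsPosForm Φ)
    (hs : ∀ A, Φ (star A) = star (Φ A)) : ∃ Ψ : Op H →CP Op K, Ψ.toLinearMap = Φ := by
  refine ⟨⟨Φ, fun n M hM => nonneg_of_re_sum_inner_nonneg _ ?_ fun x => ?_⟩, rfl⟩
  · ext1 i j
    rw [CStarMatrix.star_apply, CStarMatrix.map_apply, CStarMatrix.map_apply, ← hs,
      ← CStarMatrix.star_apply, (IsSelfAdjoint.of_nonneg hM).star_eq]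
  · obtain ⟨C, rfl⟩ := exists_eq_star_mul_self hM
    have e : ∑ i, ∑ j, inner ℂ (x i) ((star C * C).map Φ i j (x j)) =
        ∑ k, ∑ i, ∑ j, inner ℂ (x i) (Φ (star (C k i) * C k j) (x j)) := by
      simp only [CStarMatrix.map_apply, CStarMatrix.mul_apply, CStarMatrix.star_apply, map_sum,
        _root_.sum_apply, inner_sum]
      rw [Finset.sum_comm_cycle]
    rw [e, Complex.re_sum]
    exact Finset.sum_nonneg fun k _ => h n _ x

/-- The Kadison-Schwarz inequality `Φ(A)† Φ(A) ≤ Φ(A† A)`. -/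
theorem IsPosForm.schwarz {Φ : Op H →ₗ[ℂ] Op K} (h : IsPosForm Φ) (h1 : Φ 1 = 1)
    (hs : ∀ A, Φ (star A) = star (Φ A)) (A : Op H) :
    star (Φ A) * Φ A ≤ Φ (star A * A) := by
  rw [← sub_nonneg, op_nonneg_iff]
  refine ⟨?_, fun x => ?_⟩
  · rw [IsSelfAdjoint, star_sub, ← hs, star_mul, star_mul, star_star, star_star]
  · -- The block matrix with entries `1, A, A†, A† A`, tested on the vector `(-Φ(A) x, x)`.
    have := h 2 ![1, A] ![-Φ A x, x]
    simp only [Fin.sum_univ_two, Matrix.cons_val_zero, Matrix.cons_val_one, star_one, one_mul,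
      mul_one, h1, hs, inner_neg_left, map_neg, inner_neg_right, neg_neg,
      one_apply_eq_self] at this
    rw [_root_.sub_apply, inner_sub_right, inner_star_mul]
    rw [ContinuousLinearMap.star_eq_adjoint, ContinuousLinearMap.adjoint_inner_right] at this
    simp only [Complex.add_re, Complex.neg_re, Complex.sub_re] at this ⊢
    linarith

end CP

/-! ### The trace as a faithful functional -/

section Trace

variable {H : Type*} [NormedAddCommGroup H] [InnerProductSpace ℂ H]

theorem tr_add (A B : Op H) : tr (A + B) = tr A + tr B := by simp [tr]

theorem tr_sub (A B : Op H) : tr (A - B) = tr A - tr B := by simp [tr]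

theorem tr_smul (c : ℂ) (A : Op H) : tr (c • A) = c * tr A := by simp [tr]

theorem tr_mul_comm (A B : Op H) : tr (A * B) = tr (B * A) :=
  LinearMap.trace_mul_comm ℂ A.toLinearMap B.toLinearMap

variable [FiniteDimensional ℂ H]

theorem tr_eq_sum_inner (A : Op H) :
    tr A = ∑ i, inner ℂ (stdOrthonormalBasis ℂ H i) (A (stdOrthonormalBasis ℂ H i)) :=
  LinearMap.trace_eq_sum_inner _ _

variable [CompleteSpace H]

theorem re_tr_star_mul_self (A : Op H) :
    (tr (star A * A)).re = ∑ i, ‖A (stdOrthonormalBasis ℂ H i)‖ ^ 2 := by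
  rw [tr_eq_sum_inner, Complex.re_sum]
  refine Finset.sum_congr rfl fun i _ => ?_
  rw [inner_star_mul]
  exact (norm_sq_eq_re_inner (𝕜 := ℂ) _).symm

theorem re_tr_star_mul_self_nonneg (A : Op H) : 0 ≤ (tr (star A * A)).re := by
  rw [re_tr_star_mul_self]
  positivity

theorem eq_zero_of_re_tr_star_mul_self {A : Op H} (h : (tr (star A * A)).re = 0) : A = 0 := by
  rw [re_tr_star_mul_self, Finset.sum_eq_zero_iff_of_nonneg fun i _ => by positivity] at h
  refine ContinuousLinearMap.coe_injective ((stdOrthonormalBasis ℂ H).toBasis.ext fun i => ?_)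
  simpa using h i (Finset.mem_univ i)

theorem re_tr_nonneg {A : Op H} (hA : 0 ≤ A) : 0 ≤ (tr A).re := by
  obtain ⟨C, rfl⟩ := exists_eq_star_mul_self hA
  exact re_tr_star_mul_self_nonneg C

theorem eq_zero_of_re_tr {A : Op H} (hA : 0 ≤ A) (h : (tr A).re = 0) : A = 0 := by
  obtain ⟨C, rfl⟩ := exists_eq_star_mul_self hA
  rw [eq_zero_of_re_tr_star_mul_self h, mul_zero]

theorem re_tr_star (A : Op H) : (tr (star A)).re = (tr A).re := by
  rw [tr_star]; rfl

theorem re_tr_mul_nonneg {S A : Op H} (hS : 0 ≤ S) (hA : 0 ≤ A) : 0 ≤ (tr (S * A)).re := by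
  obtain ⟨C, rfl⟩ := exists_eq_star_mul_self hS
  rw [mul_assoc, tr_mul_comm]
  exact re_tr_nonneg (star_right_conjugate_nonneg hA C)

theorem eq_zero_of_re_tr_mul {S A : Op H} (hS : IsStrictlyPositive S) (hA : 0 ≤ A)
    (h : (tr (S * A)).re = 0) : A = 0 := by
  obtain ⟨C, rfl⟩ := exists_eq_star_mul_self hA
  have hs := CFC.sqrt_mul_sqrt_self S hS.nonneg
  have hsa : star (CFC.sqrt S) = CFC.sqrt S := (IsSelfAdjoint.of_nonneg (CFC.sqrt_nonneg S)).star_eq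
  have h0 : C * CFC.sqrt S = 0 := by
    apply eq_zero_of_re_tr_star_mul_self
    rw [star_mul, hsa, ← h, mul_assoc, tr_mul_comm, tr_mul_comm S]
    conv_rhs => rw [← hs]
    simp only [mul_assoc]
  rw [(hS.isUnit_cfcSqrt).mul_left_eq_zero.mp h0, mul_zero]

theorem eq_of_tr_mul_eq {C D : Op H} (h : ∀ A, tr (C * A) = tr (D * A)) : C = D := by
  rw [← sub_eq_zero, ← star_eq_zero]
  apply eq_zero_of_re_tr_star_mul_self
  rw [star_star, sub_mul, tr_sub, h, sub_self, Complex.zero_re]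

end Trace

/-! ### The Hilbert-Schmidt adjoint of a channel -/

section Adjoint

variable {H K : Type*} [NormedAddCommGroup H] [InnerProductSpace ℂ H] [CompleteSpace H]
  [NormedAddCommGroup K] [InnerProductSpace ℂ K] [CompleteSpace K]

theorem map_star_of_completelyPositive (Φ : Op H →CP Op K) (A : Op H) :
    Φ.toLinearMap (star A) = star (Φ.toLinearMap A) := by
  have hsa (B : Op H) (hB : IsSelfAdjoint B) : star (Φ.toLinearMap B) = Φ.toLinearMap B := by
    rw [← CFC.posPart_sub_negPart B hB, map_sub, star_sub]
    have h (C : Op H) (hC : 0 ≤ C) : star (Φ.toLinearMap C) = Φ.toLinearMap C :=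
      (IsSelfAdjoint.of_nonneg (map_nonneg Φ hC)).star_eq
    rw [h _ (CFC.posPart_nonneg B), h _ (CFC.negPart_nonneg B)]
  conv_lhs => rw [← realPart_add_I_smul_imaginaryPart A]
  conv_rhs => rw [← realPart_add_I_smul_imaginaryPart A]
  simp only [star_add, star_smul, map_add, map_smul, hsa _ (realPart A).2,
    hsa _ (imaginaryPart A).2, (realPart A).2.star_eq, (imaginaryPart A).2.star_eq]

theorem IsPosForm.map_nonneg {Φ : Op H →ₗ[ℂ] Op K} (h : IsPosForm Φ)
    (hs : ∀ A, Φ (star A) = star (Φ A)) {A : Op H} (hA : 0 ≤ A) : 0 ≤ Φ A := by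
  refine (op_nonneg_iff _).mpr ⟨?_, fun x => ?_⟩
  · rw [IsSelfAdjoint, ← hs, (IsSelfAdjoint.of_nonneg hA).star_eq]
  · obtain ⟨C, rfl⟩ := exists_eq_star_mul_self hA
    simpa using h 1 (fun _ => C) fun _ => x

variable [FiniteDimensional ℂ H]

/-- `hsAdjoint N` as a linear map. -/
def hsAdjointₗ (N : Op H →ₗ[ℂ] Op K) : Op K →ₗ[ℂ] Op H where
  toFun := hsAdjoint N
  map_add' A B := by
    simp only [hsAdjoint, hsInner, mul_add, tr_add, add_smul, Finset.sum_add_distrib]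
  map_smul' c A := by
    simp only [hsAdjoint, hsInner_smul_right, mul_smul, Finset.smul_sum, RingHom.id_apply]

variable [FiniteDimensional ℂ K] {N : Op H →ₗ[ℂ] Op K}

theorem hsAdjoint_star (hs : ∀ A, N (star A) = star (N A)) (B : Op K) :
    hsAdjoint N (star B) = star (hsAdjoint N B) := by
  have h : (fun B => star (hsAdjoint N (star B))) = hsAdjoint N := by
    refine eq_hsAdjoint N _ fun A B => ?_
    have h := hsInner_hsAdjoint N (star A) (star B)
    rw [hs, hsInner, hsInner, star_star, ← star_inj, ← tr_star, ← tr_star, star_mul, star_mul,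
      star_star, star_star, star_star, tr_mul_comm, tr_mul_comm A] at h
    rw [hsInner, hsInner, h, star_star]
  rw [← congrFun h B, star_star]

theorem tr_mul_apply (hs : ∀ A, N (star A) = star (N A)) (A : Op H) (B : Op K) :
    tr (B * N A) = tr (hsAdjoint N B * A) := by
  have h := hsInner_hsAdjoint N A (star B)
  rwa [hsAdjoint_star hs, hsInner, hsInner, star_star, star_star] at h

theorem hsAdjoint_one (hs : ∀ A, N (star A) = star (N A)) (ht : ∀ A, tr (N A) = tr A) :
    hsAdjoint N 1 = 1 := by
  refine eq_of_tr_mul_eq fun A => ?_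
  rw [← tr_mul_apply hs, one_mul, one_mul, ht]

/-- The adjoint of a completely positive map is completely positive. With `bᵢ = |e⟩⟨xᵢ|` for a unit
vector `e`, the form of `N†` at `(a, x)` is a sum of forms of `N` at `b` and `aᵢ† fₖ`, where `fₖ`
runs through an orthonormal basis. -/
theorem IsPosForm.hsAdjointₗ (h : IsPosForm N) (hs : ∀ A, N (star A) = star (N A)) :
    IsPosForm (hsAdjointₗ N) := by
  intro n a x
  rcases subsingleton_or_nontrivial H with hH | hH
  · simp [Subsingleton.elim (x _) 0]
  obtain ⟨e, he⟩ := exists_norm_eq H zero_le_one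
  let b (i : Fin n) : Op H := InnerProductSpace.rankOne ℂ e (x i)
  have hb (i j : Fin n) : star (b j) * b i = InnerProductSpace.rankOne ℂ (x j) (x i) := by
    ext z
    simp [b, ContinuousLinearMap.star_eq_adjoint, he, inner_self_eq_norm_sq_to_K]
  have e1 (i j : Fin n) : inner ℂ (x i) (MinMaxRecovery.hsAdjointₗ N (star (a i) * a j) (x j)) =
      ∑ k, inner ℂ (star (a j) (stdOrthonormalBasis ℂ K k))
        (N (star (b j) * b i) (star (a i) (stdOrthonormalBasis ℂ K k))) := by
    have h1 := hsInner_rankOne (star (hsAdjoint N (star (a i) * a j))) (x j) (x i)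
    rw [star_star] at h1
    refine h1.symm.trans ?_
    rw [hsInner, star_star, ← hb, ← tr_mul_apply hs, mul_assoc, tr_mul_comm, mul_assoc,
      tr_eq_sum_inner]
    refine Finset.sum_congr rfl fun k _ => ?_
    conv_lhs => rw [← star_star (a j), inner_star_mul]
    rfl
  simp only [e1]
  rw [Finset.sum_comm_cycle, Complex.re_sum]
  refine Finset.sum_nonneg fun k _ => ?_
  rw [Finset.sum_comm]
  exact h n b _

end Adjoint

/-! ### Linear independence of partial fractions -/

section PartialFractions

open Polynomial in
/-- The functions `s ↦ s / (a + s)`, `a > 0`, are linearly independent, so a linear relation among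
them for the values `a = r k` passes to any other function of the `r k`. The `r k` need not be
distinct. -/
theorem sum_mul_eq_zero_of_sum_resolvent_eq_zero {ι : Type*} [Fintype ι] (r : ι → ℝ)
    (hr : ∀ k, 0 < r k) (e : ι → ℂ)
    (h : ∀ s : ℝ, 0 < s → ∑ k, ((s / (r k + s) : ℝ) : ℂ) * e k = 0) (f : ℝ → ℂ) :
    ∑ k, f (r k) * e k = 0 := by
  classical
  set S : Finset ℝ := Finset.univ.image r with hS
  have hpos : ∀ a ∈ S, 0 < a := by simpa [hS] using hr
  let v (a : ℝ) : ℂ := ∑ k with r k = a, e k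
  have key (g : ℝ → ℂ) : ∑ k, g (r k) * e k = ∑ a ∈ S, g a * v a := by
    rw [← Finset.sum_fiberwise_of_maps_to (t := S) (g := r)
      (fun k _ => Finset.mem_image_of_mem r (Finset.mem_univ k))]
    refine Finset.sum_congr rfl fun a _ => ?_
    rw [Finset.mul_sum]
    exact Finset.sum_congr rfl fun k hk => by rw [(Finset.mem_filter.mp hk).2]
  -- The numerator of `∑ v a / (a + X)`: it vanishes on the positive reals, hence identically, and
  -- its value at `-a` is a nonzero multiple of `v a`.
  let P : ℂ[X] := ∑ a ∈ S, C (v a) * ∏ b ∈ S.erase a, (X + C (b : ℂ))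
  have hroot : ∀ s : ℝ, 0 < s → P.IsRoot (s : ℂ) := by
    intro s hs
    have h1 := h s hs
    rw [key fun a => ((s / (a + s) : ℝ) : ℂ)] at h1
    have h2 : (s : ℂ) * P.eval (s : ℂ) =
        (∏ b ∈ S, ((s : ℂ) + b)) * ∑ a ∈ S, ((s / (a + s) : ℝ) : ℂ) * v a := by
      simp only [P, eval_finsetSum, eval_mul, eval_C, eval_prod, eval_add, eval_X, Finset.mul_sum]
      refine Finset.sum_congr rfl fun a ha => ?_
      rw [← Finset.mul_prod_erase S _ ha]
      have : (a : ℂ) + s ≠ 0 := by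
        exact_mod_cast (add_pos (hpos a ha) hs).ne'
      push_cast
      field_simp
      ring
    rw [h1, mul_zero] at h2
    exact (mul_eq_zero.mp h2).resolve_left (by exact_mod_cast hs.ne')
  have hP : P = 0 := by
    refine eq_zero_of_infinite_isRoot P (Set.Infinite.mono ?_
      ((Set.Ioi_infinite (0 : ℝ)).image Complex.ofReal_injective.injOn))
    rintro _ ⟨s, hs, rfl⟩
    exact hroot s hs
  have hv : ∀ a ∈ S, v a = 0 := by
    intro a ha
    have h1 : P.eval (-(a : ℂ)) = 0 := by rw [hP, eval_zero]
    simp only [P, eval_finsetSum, eval_mul, eval_C, eval_prod, eval_add, eval_X] at h1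
    rw [Finset.sum_eq_single a _ (fun h => absurd ha h)] at h1
    · refine (mul_eq_zero.mp h1).resolve_right (Finset.prod_ne_zero_iff.mpr fun b hb => ?_)
      have : b ≠ a := Finset.ne_of_mem_erase hb
      rw [neg_add_eq_sub, sub_ne_zero]
      exact_mod_cast this
    · intro b _ hb
      rw [Finset.prod_eq_zero (Finset.mem_erase.mpr ⟨hb.symm, ha⟩) (neg_add_cancel (a : ℂ)),
        mul_zero]
  rw [key f]
  exact Finset.sum_eq_zero fun a ha => by rw [hv a ha, mul_zero]

/-- Operator partial fractions that agree for all `s > 0` agree after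
`s / (x + s)` is replaced by any function `f x`. -/
theorem sum_smul_eq_of_sum_resolvent_eq {H : Type*} [NormedAddCommGroup H]
    [InnerProductSpace ℂ H] {ι κ : Type*} [Fintype ι] [Fintype κ]
    (r : ι → ℝ) (hr : ∀ k, 0 < r k) (c : ι → Op H) (t : κ → ℝ) (ht : ∀ k, 0 < t k) (d : κ → Op H)
    (h : ∀ s : ℝ, 0 < s → ∑ k, ((s / (r k + s) : ℝ) : ℂ) • c k =
      ∑ l, ((s / (t l + s) : ℝ) : ℂ) • d l) (f : ℝ → ℂ) :
    ∑ k, f (r k) • c k = ∑ l, f (t l) • d l := by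
  ext y
  refine ext_inner_left ℂ fun x => ?_
  have key := sum_mul_eq_zero_of_sum_resolvent_eq_zero (Sum.elim r t)
    (fun k => by cases k; exacts [hr _, ht _])
    (Sum.elim (fun k => inner ℂ x (c k y)) fun l => -inner ℂ x (d l y)) (fun s hs => ?_) f
  · simp only [Fintype.sum_sum_type, Sum.elim_inl, Sum.elim_inr, mul_neg,
      Finset.sum_neg_distrib] at key
    simpa only [_root_.sum_apply, _root_.smul_apply, inner_sum, inner_smul_right]
      using eq_of_sub_eq_zero ((sub_eq_add_neg _ _).trans key)
  · have h1 := congrArg (fun A : Op H => inner ℂ x (A y)) (h s hs)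
    simp only [_root_.sum_apply, _root_.smul_apply, inner_sum,
      inner_smul_right] at h1
    simp only [Fintype.sum_sum_type, Sum.elim_inl, Sum.elim_inr, mul_neg,
      Finset.sum_neg_distrib, h1, add_neg_cancel]

end PartialFractions

/-! ### Spectral expansion of the relative modular operator -/

section Spectral

variable {H : Type*} [NormedAddCommGroup H] [InnerProductSpace ℂ H] [CompleteSpace H]

theorem sqrt_mul_rpow_neg_half {S : Op H} (hS : IsStrictlyPositive S) :
    CFC.sqrt S * S ^ (-1 / 2 : ℝ) = 1 := by
  rw [CFC.sqrt_eq_rpow, neg_div, CFC.rpow_mul_rpow_neg _ hS]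

variable [FiniteDimensional ℂ H]

theorem exists_spectral_resolution (T : Op H) (hT : IsStrictlyPositive T) :
    ∃ (t : Fin (Module.finrank ℂ H) → ℝ) (P : Fin (Module.finrank ℂ H) → Op H),
      (∀ i, 0 < t i) ∧ (∀ i, T * P i = (t i : ℂ) • P i) ∧ (∀ i, P i * T = (t i : ℂ) • P i) ∧
        ∑ i, P i = 1 := by
  have hpos := (ContinuousLinearMap.nonneg_iff_isPositive T).mp hT.nonneg
  have hsym : T.toLinearMap.IsSymmetric := hpos.isSymmetric
  let b := hsym.eigenvectorBasis rfl
  let t := hsym.eigenvalues rfl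
  have hb (i) : T (b i) = (t i : ℂ) • b i := hsym.apply_eigenvectorBasis rfl i
  let P (i) : Op H := InnerProductSpace.rankOne ℂ (b i) (b i)
  have hP (i) : star (P i) = P i := by
    simp [P, ContinuousLinearMap.star_eq_adjoint]
  have hTP (i) : T * P i = (t i : ℂ) • P i := by
    ext x
    simpa [P, hb] using smul_comm _ _ _
  refine ⟨t, P, fun i => ?_, hTP, fun i => ?_, ?_⟩
  · have h0 : 0 ≤ t i := by
      have := ((op_nonneg_iff T).mp hT.nonneg).2 (b i)
      rw [hb, inner_smul_right, inner_self_eq_norm_sq_to_K, b.orthonormal.1 i] at this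
      simpa using this
    refine h0.lt_of_ne fun h => ?_
    have h1 : T (b i) = 0 := by rw [hb, ← h]; simp
    obtain ⟨u, hu⟩ := hT.isUnit
    have h2 : b i = 0 := by
      have h3 : (↑u⁻¹ * T : Op H) (b i) = b i := by rw [← hu, Units.inv_mul]; rfl
      rw [← h3]
      exact (congrArg (↑u⁻¹ : Op H) h1).trans (map_zero (↑u⁻¹ : Op H))
    exact b.orthonormal.ne_zero i h2
  · have := congrArg star (hTP i)
    rwa [star_mul, hP, star_smul, hP, (IsSelfAdjoint.of_nonneg hT.nonneg).star_eq,
      Complex.star_def, Complex.conj_ofReal] at this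
  · ext x
    simpa [P, _root_.sum_apply] using b.sum_repr' x

/-- Spectral expansion at `1` of the relative modular operator `Δ(A) = ρ A σ⁻¹`. The solution
`s (Δ + s)⁻¹ 1` of `ρ A + s A σ = s σ` and `√Δ 1 = √ρ σ^{-1/2}` are sums over the same operators
`c k`, which are constructed as eigenvectors of `Δ` with eigenvalues `r k` and sum `1`. -/
theorem exists_resolvent_expansion {ρ σ : Op H} (hρ : IsStrictlyPositive ρ)
    (hσ : IsStrictlyPositive σ) :
    ∃ (n : ℕ) (r : Fin n × Fin n → ℝ) (c : Fin n × Fin n → Op H), (∀ k, 0 < r k) ∧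
      (∀ s : ℝ, 0 < s → ρ * (∑ k, ((s / (r k + s) : ℝ) : ℂ) • c k) +
        (s : ℂ) • ((∑ k, ((s / (r k + s) : ℝ) : ℂ) • c k) * σ) = (s : ℂ) • σ) ∧
      ∑ k, ((√(r k) : ℝ) : ℂ) • c k = CFC.sqrt ρ * σ ^ (-1 / 2 : ℝ) := by
  obtain ⟨p, P, hp, hP, -, hP1⟩ := exists_spectral_resolution _ hρ.sqrt
  obtain ⟨q, Q, hq, -, hQ, hQ1⟩ := exists_spectral_resolution _ hσ.sqrt
  have hρP (i) : ρ * P i = ((p i ^ 2 : ℝ) : ℂ) • P i := by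
    rw [← CFC.sqrt_mul_sqrt_self ρ hρ.nonneg, mul_assoc, hP, mul_smul_comm, hP, smul_smul]
    push_cast; rw [sq]
  have hQσ (j) : Q j * σ = ((q j ^ 2 : ℝ) : ℂ) • Q j := by
    rw [← CFC.sqrt_mul_sqrt_self σ hσ.nonneg, ← mul_assoc, hQ, smul_mul_assoc, hQ, smul_smul]
    push_cast; rw [sq]
  have hQi (j) : Q j * σ ^ (-1 / 2 : ℝ) = (((q j)⁻¹ : ℝ) : ℂ) • Q j := by
    have : (q j : ℂ) ≠ 0 := by exact_mod_cast (hq j).ne'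
    have h1 := congrArg (· * σ ^ (-1 / 2 : ℝ)) (hQ j)
    simp only [mul_assoc, sqrt_mul_rpow_neg_half hσ, mul_one, smul_mul_assoc] at h1
    conv_rhs => rw [h1]
    rw [smul_smul, Complex.ofReal_inv, inv_mul_cancel₀ this, one_smul]
  have hsum : ∑ k : Fin _ × Fin _, P k.1 * Q k.2 = 1 := by
    rw [Fintype.sum_prod_type, ← Finset.sum_mul_sum, hP1, hQ1, one_mul]
  refine ⟨_, fun k => p k.1 ^ 2 / q k.2 ^ 2, fun k => P k.1 * Q k.2,
    fun k => div_pos (pow_pos (hp _) 2) (pow_pos (hq _) 2), fun s hs => ?_, ?_⟩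
  · conv_rhs => rw [← one_mul σ, ← hsum]
    rw [Finset.mul_sum, Finset.sum_mul, Finset.smul_sum, ← Finset.sum_add_distrib, Finset.sum_mul,
      Finset.smul_sum]
    refine Finset.sum_congr rfl fun k _ => ?_
    rw [mul_smul_comm, smul_mul_assoc, ← mul_assoc, hρP, mul_assoc, hQσ, smul_mul_assoc,
      mul_smul_comm, smul_smul, smul_smul, smul_smul, smul_smul, ← add_smul]
    congr 1
    have h1 := hq k.2
    have h2 := hp k.1
    norm_cast
    have : p k.1 ^ 2 / q k.2 ^ 2 + s ≠ 0 := by positivity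
    field_simp
  · conv_rhs => rw [← mul_one (CFC.sqrt ρ), ← hsum]
    rw [Finset.mul_sum, Finset.sum_mul]
    refine Finset.sum_congr rfl fun k _ => ?_
    dsimp only
    rw [← mul_assoc, hP, smul_mul_assoc, smul_mul_assoc, mul_assoc, hQi, mul_smul_comm, smul_smul,
      ← Complex.ofReal_mul, ← div_pow, Real.sqrt_sq (div_pos (hp _) (hq _)).le, div_eq_mul_inv]

end Spectral

/-! ### A variational principle for the resolvents -/

section Variational

variable {H K : Type*} [NormedAddCommGroup H] [InnerProductSpace ℂ H] [CompleteSpace H]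
  [NormedAddCommGroup K] [InnerProductSpace ℂ K] [CompleteSpace K]

theorem IsCPTP.isPosForm {N : Op H →ₗ[ℂ] Op K} (hN : IsCPTP N) : IsPosForm N := by
  obtain ⟨Φ, rfl⟩ := hN.completely_positive
  exact .of_completelyPositive Φ

theorem IsCPTP.map_star {N : Op H →ₗ[ℂ] Op K} (hN : IsCPTP N) (A : Op H) :
    N (star A) = star (N A) := by
  obtain ⟨Φ, rfl⟩ := hN.completely_positive
  exact map_star_of_completelyPositive Φ A

/-- The functional `Tr ρ A A† + s Tr σ (1 - A)† (1 - A)`, a quadratic cost of splitting the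
identity into `A` and `1 - A`. -/
def splitCost (s : ℝ) (ρ σ A : Op H) : ℝ :=
  (tr (ρ * (A * star A))).re + s * (tr (σ * (star (1 - A) * (1 - A)))).re

variable [FiniteDimensional ℂ H] [FiniteDimensional ℂ K]

/-- A solution of `ρ A + s A σ = s σ` is a critical point of the cost; the excess of the cost at
`A + D` is the quadratic form at `D`. -/
theorem splitCost_add {s : ℝ} {ρ σ A : Op H} (hρ : IsSelfAdjoint ρ) (hσ : IsSelfAdjoint σ)
    (hA : ρ * A + (s : ℂ) • (A * σ) = (s : ℂ) • σ) (D : Op H) :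
    splitCost s ρ σ (A + D) = splitCost s ρ σ A +
      ((tr (ρ * (D * star D))).re + s * (tr (σ * (star D * D))).re) := by
  have h1 : (tr (ρ * (D * star A))).re = (tr (ρ * A * star D)).re := by
    rw [← re_tr_star, star_mul, star_mul, star_star, hρ.star_eq, tr_mul_comm, mul_assoc]
  have h2 : (tr (σ * (star (1 - A) * D))).re = (tr ((1 - A) * σ * star D)).re := by
    rw [← re_tr_star, star_mul, star_mul, star_star, hσ.star_eq, mul_assoc, tr_mul_comm]
  have h3 : (tr (σ * (star D * (1 - A)))).re = (tr ((1 - A) * σ * star D)).re := by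
    rw [← mul_assoc, tr_mul_comm, mul_assoc]
  have h4 : (tr (ρ * A * star D)).re = s * (tr ((1 - A) * σ * star D)).re := by
    have : ρ * A = (s : ℂ) • ((1 - A) * σ) := by
      rw [sub_mul, one_mul, smul_sub, ← hA, add_sub_cancel_right]
    rw [this, smul_mul_assoc, tr_smul, Complex.re_ofReal_mul]
  have e1 : ρ * ((A + D) * star (A + D)) =
      ρ * (A * star A) + ρ * A * star D + ρ * (D * star A) + ρ * (D * star D) := by
    rw [star_add]; noncomm_ring
  have e2 : σ * (star (1 - (A + D)) * (1 - (A + D))) =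
      σ * (star (1 - A) * (1 - A)) - σ * (star D * (1 - A)) - σ * (star (1 - A) * D) +
        σ * (star D * D) := by
    rw [← sub_sub, star_sub (1 - A)]; noncomm_ring
  rw [splitCost, splitCost, e1, e2]
  simp only [tr_add, tr_sub, Complex.add_re, Complex.sub_re, h1, h2, h3, h4]
  ring

/-- The cost decreases under the adjoint of a channel, by the Kadison-Schwarz inequality. -/
theorem splitCost_hsAdjoint_le {s : ℝ} (hs : 0 ≤ s) {ρ σ : Op H} (hρ : 0 ≤ ρ) (hσ : 0 ≤ σ)
    {N : Op H →ₗ[ℂ] Op K} (hN : IsCPTP N) (A : Op K) :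
    splitCost s ρ σ (hsAdjoint N A) ≤ splitCost s (N ρ) (N σ) A := by
  have hst := hsAdjoint_star (N := N) hN.map_star
  have h1 := hsAdjoint_one hN.map_star hN.trace_preserving
  have key (τ : Op H) (hτ : 0 ≤ τ) (B : Op K) :
      (tr (τ * (star (hsAdjoint N B) * hsAdjoint N B))).re ≤ (tr (N τ * (star B * B))).re := by
    have hsw : star (hsAdjoint N B) * hsAdjoint N B ≤ hsAdjoint N (star B * B) :=
      (hN.isPosForm.hsAdjointₗ hN.map_star).schwarz h1 hst B
    have h2 := re_tr_mul_nonneg hτ (sub_nonneg.mpr hsw)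
    rw [tr_mul_comm (N τ), tr_mul_apply hN.map_star, tr_mul_comm _ τ]
    rwa [mul_sub, tr_sub, Complex.sub_re, sub_nonneg] at h2
  have h3 : hsAdjoint N (1 - A) = 1 - hsAdjoint N A := by
    rw [← h1]; exact map_sub (hsAdjointₗ N) 1 A
  refine add_le_add ?_ (mul_le_mul_of_nonneg_left ?_ hs)
  · simpa only [hst, star_star] using key ρ hρ (star A)
  · simpa only [h3] using key σ hσ (1 - A)

/-- If a channel recovers `ρ` and `σ`, both costs have the same minimum, so `N†` maps the minimizer
for `(N ρ, N σ)` to a minimizer for `(ρ, σ)`, and the latter is unique. -/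
theorem hsAdjoint_eq_of_recovery {s : ℝ} (hs : 0 < s) {ρ σ : Op H} (hρ : 0 ≤ ρ)
    (hσ : IsStrictlyPositive σ) {N : Op H →ₗ[ℂ] Op K} {R : Op K →ₗ[ℂ] Op H}
    (hN : IsCPTP N) (hR : IsCPTP R) (hRρ : R (N ρ) = ρ) (hRσ : R (N σ) = σ) {A : Op H} {B : Op K}
    (hA : ρ * A + (s : ℂ) • (A * σ) = (s : ℂ) • σ)
    (hB : N ρ * B + (s : ℂ) • (B * N σ) = (s : ℂ) • N σ) : hsAdjoint N B = A := by
  have hNρ : 0 ≤ N ρ := hN.isPosForm.map_nonneg hN.map_star hρ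
  have hNσ : 0 ≤ N σ := hN.isPosForm.map_nonneg hN.map_star hσ.nonneg
  have h1 := splitCost_hsAdjoint_le hs.le hρ hσ.nonneg hN B
  have h2 := splitCost_hsAdjoint_le hs.le hNρ hNσ hR A
  rw [hRρ, hRσ] at h2
  have h3 := splitCost_add (.of_nonneg hNρ) (.of_nonneg hNσ) hB (hsAdjoint R A - B)
  have h4 := splitCost_add (.of_nonneg hρ) (.of_nonneg hσ.nonneg) hA (hsAdjoint N B - A)
  rw [add_sub_cancel] at h3 h4
  set D := hsAdjoint R A - B
  set E := hsAdjoint N B - A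
  have p1 := re_tr_mul_nonneg hNρ (mul_star_self_nonneg D)
  have p2 := re_tr_mul_nonneg hNσ (star_mul_self_nonneg D)
  have p3 := re_tr_mul_nonneg hρ (mul_star_self_nonneg E)
  have p4 := re_tr_mul_nonneg hσ.nonneg (star_mul_self_nonneg E)
  have p2' := mul_nonneg hs.le p2
  have p4' := mul_nonneg hs.le p4
  have h0 : s * (tr (σ * (star E * E))).re = 0 := by linarith
  have hE := eq_zero_of_re_tr_mul hσ (star_mul_self_nonneg E)
    ((mul_eq_zero.mp h0).resolve_left hs.ne')
  exact sub_eq_zero.mp ((CStarRing.star_mul_self_eq_zero_iff E).mp hE)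

end Variational

/-! ### Sufficiency and the Petz map -/

section Petz

variable {H K : Type*} [NormedAddCommGroup H] [InnerProductSpace ℂ H] [CompleteSpace H]
  [NormedAddCommGroup K] [InnerProductSpace ℂ K] [CompleteSpace K]

theorem rpow_neg_half_mul_sqrt {S : Op H} (hS : IsStrictlyPositive S) :
    S ^ (-1 / 2 : ℝ) * CFC.sqrt S = 1 := by
  rw [CFC.sqrt_eq_rpow, neg_div, CFC.rpow_neg_mul_rpow _ hS]

theorem star_rpow (S : Op H) (x : ℝ) : star (S ^ x) = S ^ x :=
  (IsSelfAdjoint.of_nonneg CFC.rpow_nonneg).star_eq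

theorem conj_rpow_neg_half {S : Op H} (hS : IsStrictlyPositive S) :
    S ^ (-1 / 2 : ℝ) * S * S ^ (-1 / 2 : ℝ) = 1 := by
  rw [neg_div, CFC.conjugate_rpow_neg_one_half S hS]

theorem tr_conj_rpow_neg_half_mul {S : Op H} (hS : IsStrictlyPositive S) (A : Op H) :
    tr (S ^ (-1 / 2 : ℝ) * A * S ^ (-1 / 2 : ℝ) * S) = tr A := by
  rw [mul_assoc, mul_assoc, tr_mul_comm, mul_assoc, mul_assoc, tr_mul_comm,
    ← mul_assoc (S ^ _), conj_rpow_neg_half hS, one_mul]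

variable [FiniteDimensional ℂ H]

/-- `petz σ N` as a linear map. -/
def petzₗ (σ : Op H) (N : Op H →ₗ[ℂ] Op K) : Op K →ₗ[ℂ] Op H :=
  LinearMap.mulRight ℂ (σ ^ (1 / 2 : ℝ)) ∘ₗ LinearMap.mulLeft ℂ (σ ^ (1 / 2 : ℝ)) ∘ₗ
    hsAdjointₗ N ∘ₗ LinearMap.mulRight ℂ ((N σ) ^ (-1 / 2 : ℝ)) ∘ₗ
      LinearMap.mulLeft ℂ ((N σ) ^ (-1 / 2 : ℝ))

theorem petzₗ_apply (σ : Op H) (N : Op H →ₗ[ℂ] Op K) (ω : Op K) : petzₗ σ N ω = petz σ N ω := rfl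

variable [FiniteDimensional ℂ K]

/-- The resolvent identities of `hsAdjoint_eq_of_recovery`, for all `s > 0`, yield the square root
of the relative modular operator. -/
theorem hsAdjoint_sqrt_mul_rpow {ρ σ : Op H} (hρ : IsStrictlyPositive ρ)
    (hσ : IsStrictlyPositive σ) {N : Op H →ₗ[ℂ] Op K} (hN : IsStrictCPTP N)
    (h : IsSufficient N ρ σ) :
    hsAdjoint N (CFC.sqrt (N ρ) * (N σ) ^ (-1 / 2 : ℝ)) = CFC.sqrt ρ * σ ^ (-1 / 2 : ℝ) := by
  obtain ⟨R, hR, hRρ, hRσ⟩ := h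
  obtain ⟨n, r, c, hr, hc, hc'⟩ := exists_resolvent_expansion hρ hσ
  obtain ⟨m, t, d, ht, hd, hd'⟩ := exists_resolvent_expansion (hN.strict ρ hρ) (hN.strict σ hσ)
  have hmap (f : Fin m × Fin m → ℂ) :
      hsAdjoint N (∑ l, f l • d l) = ∑ l, f l • hsAdjoint N (d l) := by
    refine (map_sum (hsAdjointₗ N) (fun l => f l • d l) Finset.univ).trans ?_
    exact Finset.sum_congr rfl fun l _ => map_smul (hsAdjointₗ N) (f l) (d l)
  rw [← hc', ← hd', hmap]
  symm
  refine sum_smul_eq_of_sum_resolvent_eq r hr c t ht (fun l => hsAdjoint N (d l))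
    (fun s hs => ?_) fun x => ((√x : ℝ) : ℂ)
  rw [← hmap]
  exact (hsAdjoint_eq_of_recovery hs hρ.nonneg hσ hN.toIsCPTP hR hRρ hRσ (hc s hs)
    (hd s hs)).symm

/-- Petz's theorem. With `X = √ρ σ^{-1/2}` and `Y = √(N ρ) (N σ)^{-1/2}` one has `N†(Y) = X`, and
equality holds in the Kadison-Schwarz inequality `X† X ≤ N†(Y† Y)` because both sides have the
same trace against `σ`, namely `Tr ρ`. Conjugation by `√σ` then gives the claim. -/
theorem petz_apply_eq_of_isSufficient {ρ σ : Op H} (hρ : IsStrictlyPositive ρ)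
    (hσ : IsStrictlyPositive σ) {N : Op H →ₗ[ℂ] Op K} (hN : IsStrictCPTP N)
    (h : IsSufficient N ρ σ) : petz σ N (N ρ) = ρ := by
  have hNρ := hN.strict ρ hρ
  have hNσ := hN.strict σ hσ
  have hXY := hsAdjoint_sqrt_mul_rpow hρ hσ hN h
  set Y := CFC.sqrt (N ρ) * (N σ) ^ (-1 / 2 : ℝ) with hY
  set X := CFC.sqrt ρ * σ ^ (-1 / 2 : ℝ) with hX
  have hYY : star Y * Y = (N σ) ^ (-1 / 2 : ℝ) * N ρ * (N σ) ^ (-1 / 2 : ℝ) := by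
    rw [hY, star_mul, star_rpow, (IsSelfAdjoint.of_nonneg (CFC.sqrt_nonneg _)).star_eq,
      mul_assoc, ← mul_assoc (CFC.sqrt _), CFC.sqrt_mul_sqrt_self _ hNρ.nonneg, mul_assoc]
  have hXX : star X * X = σ ^ (-1 / 2 : ℝ) * ρ * σ ^ (-1 / 2 : ℝ) := by
    rw [hX, star_mul, star_rpow, (IsSelfAdjoint.of_nonneg (CFC.sqrt_nonneg _)).star_eq,
      mul_assoc, ← mul_assoc (CFC.sqrt _), CFC.sqrt_mul_sqrt_self _ hρ.nonneg, mul_assoc]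
  have hsw : star X * X ≤ hsAdjoint N (star Y * Y) := by
    rw [← hXY]
    exact (hN.isPosForm.hsAdjointₗ hN.map_star).schwarz
      (hsAdjoint_one hN.map_star hN.trace_preserving) (hsAdjoint_star hN.map_star) Y
  have heq : hsAdjoint N (star Y * Y) - star X * X = 0 := by
    refine eq_zero_of_re_tr_mul hσ (sub_nonneg.mpr hsw) ?_
    rw [tr_mul_comm, sub_mul, tr_sub, ← tr_mul_apply hN.map_star, hYY, hXX,
      tr_conj_rpow_neg_half_mul hNσ, tr_conj_rpow_neg_half_mul hσ, hN.trace_preserving,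
      sub_self, Complex.zero_re]
  rw [petz, ← hYY, sub_eq_zero.mp heq, hXX, ← CFC.sqrt_eq_rpow, mul_assoc, mul_assoc, mul_assoc,
    ← mul_assoc (CFC.sqrt σ), sqrt_mul_rpow_neg_half hσ, one_mul, rpow_neg_half_mul_sqrt hσ,
    mul_one]

theorem petz_apply_self {σ : Op H} (hσ : IsStrictlyPositive σ)
    {N : Op H →ₗ[ℂ] Op K} (hN : IsStrictCPTP N) : petz σ N (N σ) = σ := by
  rw [petz, conj_rpow_neg_half (hN.strict σ hσ), hsAdjoint_one hN.map_star hN.trace_preserving,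
    mul_one, ← CFC.sqrt_eq_rpow, CFC.sqrt_mul_sqrt_self σ hσ.nonneg]

theorem tr_petz {σ : Op H} (hσ : IsStrictlyPositive σ)
    {N : Op H →ₗ[ℂ] Op K} (hN : IsStrictCPTP N) (ω : Op K) : tr (petz σ N ω) = tr ω := by
  rw [petz, ← CFC.sqrt_eq_rpow, tr_mul_comm, ← mul_assoc, CFC.sqrt_mul_sqrt_self σ hσ.nonneg,
    tr_mul_comm, ← tr_mul_apply hN.map_star, tr_conj_rpow_neg_half_mul (hN.strict σ hσ)]

theorem isCPTP_petzₗ {σ : Op H} (hσ : IsStrictlyPositive σ)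
    {N : Op H →ₗ[ℂ] Op K} (hN : IsStrictCPTP N) : IsCPTP (petzₗ σ N) := by
  refine ⟨IsPosForm.exists_completelyPositive (fun n a x => ?_) fun A => ?_, tr_petz hσ hN⟩
  · have h := (hN.isPosForm.hsAdjointₗ hN.map_star) n (fun i => a i * (N σ) ^ (-1 / 2 : ℝ))
      fun i => (σ ^ (1 / 2 : ℝ)) (x i)
    refine h.trans_eq (congrArg Complex.re
      (Finset.sum_congr rfl fun i _ => Finset.sum_congr rfl fun j _ => ?_))
    have e : petzₗ σ N (star (a i) * a j) = star (σ ^ (1 / 2 : ℝ)) *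
        (hsAdjointₗ N (star (a i * (N σ) ^ (-1 / 2 : ℝ)) * (a j * (N σ) ^ (-1 / 2 : ℝ))) *
          σ ^ (1 / 2 : ℝ)) := by
      rw [star_mul, star_rpow, star_rpow, petzₗ_apply, petz]
      simp only [mul_assoc]
      rfl
    rw [e, inner_star_mul]
    rfl
  · simp only [petzₗ_apply, petz, star_mul, star_rpow, ← hsAdjoint_star hN.map_star, mul_assoc]

theorem isStrictlyPositive_petz {σ : Op H} (hσ : IsStrictlyPositive σ)
    {N : Op H →ₗ[ℂ] Op K} (hN : IsStrictCPTP N) {ω : Op K} (hω : IsStrictlyPositive ω) :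
    IsStrictlyPositive (petz σ N ω) := by
  have hB : IsStrictlyPositive ((N σ) ^ (-1 / 2 : ℝ) * ω * (N σ) ^ (-1 / 2 : ℝ)) :=
    .conjugate_of_isUnit_of_isSelfAdjoint _ _ ((hN.strict σ hσ).rpow _ _).isUnit (star_rpow _ _) hω
  refine .conjugate_of_isUnit_of_isSelfAdjoint _ _ (hσ.rpow _ _).isUnit (star_rpow _ _) ?_
  rcases subsingleton_or_nontrivial K with hK | hK
  · rw [Subsingleton.elim ((N σ) ^ (-1 / 2 : ℝ) * ω * (N σ) ^ (-1 / 2 : ℝ)) 1,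
      hsAdjoint_one hN.map_star hN.trace_preserving]
    exact isStrictlyPositive_one
  obtain ⟨r, hr, hrB⟩ :=
    (CFC.exists_pos_algebraMap_le_iff hB.isSelfAdjoint).2 fun x hx => hB.spectrum_pos hx
  refine IsStrictlyPositive.of_le (a := algebraMap ℝ (Op H) r) (isStrictlyPositive_algebraMap hr) ?_
  have h := (hN.isPosForm.hsAdjointₗ hN.map_star).map_nonneg (hsAdjoint_star hN.map_star)
    (sub_nonneg.mpr hrB)
  have e : hsAdjointₗ N (algebraMap ℝ (Op K) r) = algebraMap ℝ (Op H) r := by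
    have : hsAdjointₗ N 1 = 1 := hsAdjoint_one hN.map_star hN.trace_preserving
    rw [Algebra.algebraMap_eq_smul_one, Algebra.algebraMap_eq_smul_one, LinearMap.map_smul_of_tower,
      this]
  rw [map_sub, e] at h
  exact sub_nonneg.mp h

theorem isSufficient_iff {ρ σ : Op H} (hρ : IsStrictlyPositive ρ)
    (hσ : IsStrictlyPositive σ) {N : Op H →ₗ[ℂ] Op K} (hN : IsStrictCPTP N) :
    IsSufficient N ρ σ ↔ petz σ N (N ρ) = ρ :=
  ⟨petz_apply_eq_of_isSufficient hρ hσ hN,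
    fun h => ⟨petzₗ σ N, isCPTP_petzₗ hσ hN, h, petz_apply_self hσ hN⟩⟩

end Petz

/-! ### Faithfulness of the min- and max-relative entropies -/

/-- If `a` is self-adjoint and `a² = x† x`, with `a` and `x` invertible, then `x a⁻¹` is unitary. -/
theorem exists_unitary_of_mul_self_eq {M : Type*} [Monoid M] [StarMul M] {a x : M}
    (ha : star a = a) (hua : IsUnit a) (hx : IsUnit x) (h : a * a = star x * x) :
    ∃ u : M, star u * u = 1 ∧ u * star u = 1 ∧ a = star u * x := by
  obtain ⟨a, rfl⟩ := hua
  have hV : star (↑a⁻¹ : M) = ↑a⁻¹ := by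
    refine Units.eq_inv_of_mul_eq_one_left ?_
    have h1 := congrArg star (Units.inv_mul a)
    rwa [star_mul, ha, star_one] at h1
  have h1 : star (x * ↑a⁻¹) * (x * ↑a⁻¹) = 1 := by
    rw [star_mul, hV, mul_assoc, ← mul_assoc (star x), ← h, mul_assoc, Units.mul_inv, mul_one,
      Units.inv_mul]
  refine ⟨x * ↑a⁻¹, h1, ?_, ?_⟩
  · have hU : IsUnit (x * (↑a⁻¹ : M)) := hx.mul a⁻¹.isUnit
    exact hU.mul_right_cancel (by rw [mul_assoc, h1, mul_one, one_mul])
  · rw [star_mul, hV, mul_assoc, ← h, Units.inv_mul_cancel_left]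

section Entropies

variable {H : Type*} [NormedAddCommGroup H] [InnerProductSpace ℂ H] [CompleteSpace H]

theorem isSelfAdjoint_sqrt (A : Op H) : star (CFC.sqrt A) = CFC.sqrt A :=
  (IsSelfAdjoint.of_nonneg (CFC.sqrt_nonneg A)).star_eq

/-- Polar decomposition of an invertible operator. -/
theorem exists_unitary_mul_abs {X : Op H} (hX : IsUnit X) :
    ∃ U : Op H, star U * U = 1 ∧ U * star U = 1 ∧ CFC.abs X = star U * X := by
  refine exists_unitary_of_mul_self_eq (isSelfAdjoint_sqrt (star X * X)) ?_ hX (CFC.abs_mul_abs X)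
  exact (CFC.isUnit_sqrt_iff _ (star_mul_self_nonneg X)).mpr (hX.star.mul hX)

variable {ρ τ : Op H}

theorem fidelity_self (hρ : IsPosDefState ρ) : fidelity ρ ρ = 1 := by
  rw [fidelity, CFC.sqrt_mul_sqrt_self ρ hρ.1.nonneg, CFC.abs_of_nonneg ρ hρ.1.nonneg, hρ.2]
  simp

variable [FiniteDimensional ℂ H]

/-- For the unitary `U` with `|√ρ √τ| = U† √ρ √τ`, the squared Hilbert-Schmidt distance of `√ρ U`
and `√τ` is `2 - 2 Tr |√ρ √τ|`. -/
theorem re_tr_abs_le_one (hρ : IsPosDefState ρ) (hτ : IsPosDefState τ) :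
    (tr (CFC.abs (CFC.sqrt ρ * CFC.sqrt τ))).re ≤ 1 ∧
      ((tr (CFC.abs (CFC.sqrt ρ * CFC.sqrt τ))).re = 1 → ρ = τ) := by
  obtain ⟨U, hU, hU', hab⟩ := exists_unitary_mul_abs
    (hρ.1.isUnit_cfcSqrt.mul hτ.1.isUnit_cfcSqrt)
  have hρs := CFC.sqrt_mul_sqrt_self ρ hρ.1.nonneg
  have hτs := CFC.sqrt_mul_sqrt_self τ hτ.1.nonneg
  have hr := isSelfAdjoint_sqrt ρ
  have ht := isSelfAdjoint_sqrt τ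
  rw [hab]
  have key : (tr (star (CFC.sqrt ρ * U - CFC.sqrt τ) * (CFC.sqrt ρ * U - CFC.sqrt τ))).re =
      2 - 2 * (tr (star U * (CFC.sqrt ρ * CFC.sqrt τ))).re := by
    have e : star (CFC.sqrt ρ * U - CFC.sqrt τ) * (CFC.sqrt ρ * U - CFC.sqrt τ) =
        star U * (CFC.sqrt ρ * CFC.sqrt ρ) * U + CFC.sqrt τ * CFC.sqrt τ
          - star U * (CFC.sqrt ρ * CFC.sqrt τ) - star (star U * (CFC.sqrt ρ * CFC.sqrt τ)) := by
      simp only [star_sub, star_mul, star_star, hr, ht]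
      noncomm_ring
    have h1 : tr (star U * ρ * U) = 1 := by
      rw [mul_assoc, tr_mul_comm, mul_assoc, hU', mul_one, hρ.2]
    rw [e, hρs, hτs]
    simp only [tr_add, tr_sub, Complex.add_re, Complex.sub_re, re_tr_star, h1, hτ.2, Complex.one_re]
    ring
  refine ⟨?_, fun h => ?_⟩
  · have := re_tr_star_mul_self_nonneg (CFC.sqrt ρ * U - CFC.sqrt τ)
    linarith
  · rw [h] at key
    have h2 := eq_zero_of_re_tr_star_mul_self (key.trans (by norm_num))
    rw [sub_eq_zero] at h2
    rw [← hτs]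
    nth_rw 2 [← ht]
    rw [← h2, star_mul, hr, mul_assoc, ← mul_assoc U, hU', one_mul, hρs]

theorem re_tr_abs_nonneg (ρ τ : Op H) : 0 ≤ (tr (CFC.abs (CFC.sqrt ρ * CFC.sqrt τ))).re :=
  re_tr_nonneg (CFC.sqrt_nonneg (star (CFC.sqrt ρ * CFC.sqrt τ) * (CFC.sqrt ρ * CFC.sqrt τ)))

theorem fidelity_le_one (hρ : IsPosDefState ρ) (hτ : IsPosDefState τ) : fidelity ρ τ ≤ 1 :=
  pow_le_one₀ (re_tr_abs_nonneg ρ τ) (re_tr_abs_le_one hρ hτ).1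

theorem fidelity_eq_one_iff (hρ : IsPosDefState ρ) (hτ : IsPosDefState τ) :
    fidelity ρ τ = 1 ↔ ρ = τ := by
  refine ⟨fun h => (re_tr_abs_le_one hρ hτ).2 ?_, ?_⟩
  · rw [fidelity] at h
    exact (pow_eq_one_iff_of_nonneg (re_tr_abs_nonneg ρ τ) two_ne_zero).mp h
  · rintro rfl
    exact fidelity_self hρ

theorem Dmin_nonneg (hρ : IsPosDefState ρ) (hτ : IsPosDefState τ) : 0 ≤ Dmin ρ τ := by
  rw [Dmin]
  split_ifs
  · exact le_top
  · have := Real.logb_nonpos one_lt_two (sq_nonneg _ : 0 ≤ fidelity ρ τ) (fidelity_le_one hρ hτ)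
    exact_mod_cast neg_nonneg.mpr this

theorem Dmin_eq_zero_iff (hρ : IsPosDefState ρ) (hτ : IsPosDefState τ) :
    Dmin ρ τ = 0 ↔ ρ = τ := by
  rw [← fidelity_eq_one_iff hρ hτ, Dmin]
  split_ifs with h
  · simp [h]
  · have h0 : 0 < fidelity ρ τ := lt_of_le_of_ne (sq_nonneg _) (Ne.symm h)
    refine ⟨fun h1 => ?_, fun h1 => by simp [h1]⟩
    refine Real.eq_one_of_pos_of_logb_eq_zero one_lt_two h0 ?_
    exact neg_eq_zero.mp (by exact_mod_cast h1)

theorem nonneg_of_le_smul {l : ℝ} (hρ : tr ρ = 1) (hτ : tr τ = 1)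
    (h : ρ ≤ (((2 : ℝ) ^ l : ℝ) : ℂ) • τ) : 0 ≤ l := by
  have h1 := re_tr_nonneg (sub_nonneg.mpr h)
  rw [tr_sub, tr_smul, hρ, hτ, mul_one, Complex.sub_re, Complex.ofReal_re, Complex.one_re,
    sub_nonneg] at h1
  by_contra hl
  exact h1.not_gt (Real.rpow_lt_one_of_one_lt_of_neg one_lt_two (not_le.mp hl))

theorem Dmax_nonneg (hρ : IsPosDefState ρ) (hτ : IsPosDefState τ) : 0 ≤ Dmax ρ τ := by
  refine le_sInf ?_
  rintro _ ⟨l, hl, rfl⟩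
  exact_mod_cast nonneg_of_le_smul hρ.2 hτ.2 hl

theorem Dmax_eq_zero_iff (hρ : IsPosDefState ρ) (hτ : IsPosDefState τ) :
    Dmax ρ τ = 0 ↔ ρ = τ := by
  constructor
  · intro h
    have hle (ε : ℝ) (hε : 0 < ε) : ρ ≤ (((2 : ℝ) ^ ε : ℝ) : ℂ) • τ := by
      have h1 : Dmax ρ τ < (ε : EReal) := by rw [h]; exact_mod_cast hε
      obtain ⟨_, ⟨l, hl, rfl⟩, hlε⟩ := sInf_lt_iff.mp h1
      refine hl.trans ?_
      rw [← sub_nonneg, ← sub_smul, ← Complex.ofReal_sub]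
      have h2 : 0 ≤ (2 : ℝ) ^ ε - 2 ^ l :=
        sub_nonneg.mpr (Real.rpow_le_rpow_of_exponent_le one_le_two (by exact_mod_cast hlε.le))
      rw [Complex.coe_smul]
      exact smul_nonneg h2 hτ.1.nonneg
    -- Letting `ε → 0` in the quadratic forms gives `ρ ≤ τ`, and the traces agree.
    have hρτ : 0 ≤ τ - ρ := by
      refine (op_nonneg_iff _).mpr ⟨hτ.1.isSelfAdjoint.sub hρ.1.isSelfAdjoint, fun x => ?_⟩
      have hlim : Filter.Tendsto (fun ε : ℝ => (2 : ℝ) ^ ε * (inner ℂ x (τ x)).re -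
          (inner ℂ x (ρ x)).re) (nhdsWithin 0 (Set.Ioi 0))
          (nhds ((2 : ℝ) ^ (0 : ℝ) * (inner ℂ x (τ x)).re - (inner ℂ x (ρ x)).re)) := by
        refine Filter.Tendsto.mono_left (Continuous.tendsto ?_ 0) nhdsWithin_le_nhds
        exact ((Real.continuous_const_rpow two_ne_zero).mul continuous_const).sub continuous_const
      rw [Real.rpow_zero, one_mul] at hlim
      rw [_root_.sub_apply, inner_sub_right, Complex.sub_re]
      refine ge_of_tendsto hlim (Filter.eventually_of_mem self_mem_nhdsWithin fun ε hε => ?_)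
      have := ((op_nonneg_iff _).mp (sub_nonneg.mpr (hle ε hε))).2 x
      rwa [_root_.sub_apply, inner_sub_right, _root_.smul_apply, inner_smul_right, Complex.sub_re,
        Complex.re_ofReal_mul] at this
    have := eq_zero_of_re_tr hρτ (by rw [tr_sub, hρ.2, hτ.2, sub_self, Complex.zero_re])
    exact (sub_eq_zero.mp this).symm
  · rintro rfl
    exact le_antisymm (sInf_le ⟨0, by simp, by simp⟩) (Dmax_nonneg hρ hρ)

end Entropies

end MinMaxRecovery

end

theorem mainTheorem7 {H K : Type*}
    [NormedAddCommGroup H] [InnerProductSpace ℂ H] [CompleteSpace H] [FiniteDimensional ℂ H]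
    [NormedAddCommGroup K] [InnerProductSpace ℂ K] [CompleteSpace K] [FiniteDimensional ℂ K]
    (ρ σ : MinMaxRecovery.Op H) (hρ : MinMaxRecovery.IsPosDefState ρ)
    (hσ : IsStrictlyPositive σ)
    (N : MinMaxRecovery.Op H →ₗ[ℂ] MinMaxRecovery.Op K) (hN : MinMaxRecovery.IsStrictCPTP N) :
    (0 ≤ MinMaxRecovery.deltaMin ρ σ N ∧ 0 ≤ MinMaxRecovery.deltaMax ρ σ N) ∧
    (MinMaxRecovery.deltaMin ρ σ N = 0 ↔ MinMaxRecovery.IsSufficient N ρ σ) ∧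
    (MinMaxRecovery.deltaMax ρ σ N = 0 ↔ MinMaxRecovery.IsSufficient N ρ σ) := by
  have hτ : MinMaxRecovery.IsPosDefState (MinMaxRecovery.petz σ N (N ρ)) :=
    ⟨MinMaxRecovery.isStrictlyPositive_petz hσ hN (hN.strict ρ hρ.1), by
      rw [MinMaxRecovery.tr_petz hσ hN, hN.trace_preserving, hρ.2]⟩
  rw [MinMaxRecovery.isSufficient_iff hρ.1 hσ hN]
  exact ⟨⟨MinMaxRecovery.Dmin_nonneg hρ hτ, MinMaxRecovery.Dmax_nonneg hρ hτ⟩,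
    (MinMaxRecovery.Dmin_eq_zero_iff hρ hτ).trans eq_comm,
    (MinMaxRecovery.Dmax_eq_zero_iff hρ hτ).trans eq_comm⟩
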